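/- **Theorem (Graph Linear Programming is undecidable).** A *graph* $\mathcal G=(V,D,L)$ of dimension $n$ consists of a finite set $V$ of nodes, a symmetric set $D\subseteq V\times V$ of edges (loops allowed) and a labelling $L:V\to\mathbb R^n$; put $N_v=\{v'\in V\mid (v,v')\in D\}$. A *node condition* over the variables $x_1,\dots,x_n$ is a formula built with $\wedge$ and $\vee$ (no negation) from inequalities $$\sum_{i=1}^n \bigl(a_i x_i+b_i(\odot x_i)\bigr)\le c,\qquad a_i,b_i,c\in\mathbb Q .$$ A node $v$ of $\mathcal G$ satisfies such an inequality iff $\sum_{i=1}^n \bigl(a_iL(v)_i+b_i\sum_{v'\in N_v}L(v')_i\bigr)\le c$; $\wedge$ and $\vee$ are read as "and" and "or". A *graph condition* over $x_1,\dots,x_n$ is a finite non-empty conjunction of inequalities $\sum_{i=1}^n a_ix_i\le c$ with $a_i,c\in\mathbb Q$; $\mathcal G$ satisfies such an inequality iff $\sum_{i=1}^n a_i\sum_{v\in V}L(v)_i\le c$, and it satisfies the conjunction iff it satisfies every conjunct. The problem GLP is: given $n$, a graph condition $\psi$ and a node condition $\varphi$ over the same variables $x_1,\dots,x_n$ (as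 finite words, in prefix notation), decide whether there is a graph $\mathcal G$ of dimension $n$ that satisfies $\psi$ and all of whose nodes satisfy $\varphi$. GLP is undecidable: there is no algorithm (total computable function) that, on every such input $(n,\psi,\varphi)$, correctly answers whether such a graph exists. -/

import Mathlib

namespace GLP

/-! ### Labelled graphs -/

/-- A finite undirected graph whose nodes carry labels in `ℝⁿ`.  The edge set is an arbitrary
symmetric set of pairs of nodes; in particular an edge from a node to itself is allowed. -/
structure LabeledGraph (n : ℕ) where
  /-- the nodes -/
  V : Type
  /-- there are finitely many nodes -/
  [fintypeV : Fintype V]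
  /-- the edge relation -/
  Adj : V → V → Prop
  /-- edges are undirected -/
  symm : ∀ v w, Adj v w → Adj w v
  /-- the label of a node -/
  label : V → Fin n → ℝ

attribute [instance] LabeledGraph.fintypeV

open Classical in
/-- Coordinate `i` of the sum of the labels of all neighbours of `v`. -/
noncomputable def LabeledGraph.neighSum {n : ℕ} (G : LabeledGraph n) (v : G.V) (i : Fin n) : ℝ :=
  ∑ w ∈ Finset.univ.filter (fun w => G.Adj v w), G.label w i

/-- Coordinate `i` of the sum of the labels of all nodes. -/
noncomputable def LabeledGraph.totalSum {n : ℕ} (G : LabeledGraph n) (i : Fin n) : ℝ :=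
  ∑ v : G.V, G.label v i

/-! ### Node conditions and graph conditions -/

/-- Node conditions over the variables `x₁, …, xₙ`. -/
inductive NodeCond (n : ℕ) : Type
  /-- the inequality `∑ i, (a i * xᵢ + b i * ⊙ xᵢ) ≤ c` -/
  | le (a b : Fin n → ℚ) (c : ℚ) : NodeCond n
  | and (φ₁ φ₂ : NodeCond n) : NodeCond n
  | or (φ₁ φ₂ : NodeCond n) : NodeCond n

/-- The node `v` of `G` satisfies a node condition. -/
def NodeCond.Holds {n : ℕ} (G : LabeledGraph n) (v : G.V) : NodeCond n → Prop
  | .le a b c => ∑ i, ((a i : ℝ) * G.label v i + (b i : ℝ) * G.neighSum v i) ≤ (c : ℝ)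
  | .and φ₁ φ₂ => φ₁.Holds G v ∧ φ₂.Holds G v
  | .or φ₁ φ₂ => φ₁.Holds G v ∨ φ₂.Holds G v

/-- Graph conditions over the variables `x₁, …, xₙ`. -/
inductive GraphCond (n : ℕ) : Type
  /-- the inequality `∑ i, a i * xᵢ ≤ c` -/
  | le (a : Fin n → ℚ) (c : ℚ) : GraphCond n
  | and (ψ₁ ψ₂ : GraphCond n) : GraphCond n

/-- The graph `G` satisfies a graph condition. -/
def GraphCond.Holds {n : ℕ} (G : LabeledGraph n) : GraphCond n → Prop
  | .le a c => ∑ i, (a i : ℝ) * G.totalSum i ≤ (c : ℝ)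
  | .and ψ₁ ψ₂ => ψ₁.Holds G ∧ ψ₂.Holds G

/-- A graph linear program: a graph condition and a node condition over the same variables. -/
structure Program where
  /-- the number of variables -/
  n : ℕ
  /-- the graph condition -/
  graphCond : GraphCond n
  /-- the node condition -/
  nodeCond : NodeCond n

/-- Some graph satisfies the graph condition, and all its nodes satisfy the node condition. -/
def Program.Satisfiable (P : Program) : Prop :=
  ∃ G : LabeledGraph P.n, P.graphCond.Holds G ∧ ∀ v : G.V, P.nodeCond.Holds G v

/-! ### Graph linear programs as finite words

To be the input of an algorithm, a program is written in prefix notation as a finite list of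
natural numbers. -/

/-- A rational number is written as the positive part of its numerator, the negative part of its
numerator, and its denominator (in lowest terms). -/
def ratCode (q : ℚ) : List ℕ := [q.num.toNat, (-q.num).toNat, q.den]

/-- A vector of rational numbers is written coordinate by coordinate. -/
def vecCode {n : ℕ} (a : Fin n → ℚ) : List ℕ := (List.ofFn a).flatMap ratCode

/-- Prefix notation of a node condition. -/
def NodeCond.code {n : ℕ} : NodeCond n → List ℕ
  | .le a b c => 0 :: (vecCode a ++ (vecCode b ++ ratCode c))
  | .and φ₁ φ₂ => 1 :: (φ₁.code ++ φ₂.code)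
  | .or φ₁ φ₂ => 2 :: (φ₁.code ++ φ₂.code)

/-- Prefix notation of a graph condition. -/
def GraphCond.code {n : ℕ} : GraphCond n → List ℕ
  | .le a c => 0 :: (vecCode a ++ ratCode c)
  | .and ψ₁ ψ₂ => 1 :: (ψ₁.code ++ ψ₂.code)

/-- The word that represents a graph linear program. -/
def Program.code (P : Program) : List ℕ :=
  P.n :: (P.graphCond.code ++ P.nodeCond.code)

theorem ratCode_injective : Function.Injective ratCode := by
  intro p q h
  simp only [ratCode, List.cons.injEq, and_true] at h
  obtain ⟨h₁, h₂, h₃⟩ := h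
  exact Rat.ext (by omega) h₃

theorem ratCode_append {p q : ℚ} {r s : List ℕ} (h : ratCode p ++ r = ratCode q ++ s) :
    p = q ∧ r = s := by
  obtain ⟨h₁, h₂⟩ := List.append_inj h (by simp [ratCode])
  exact ⟨ratCode_injective h₁, h₂⟩

theorem vecCode_append {n : ℕ} {a b : Fin n → ℚ} {r s : List ℕ}
    (h : vecCode a ++ r = vecCode b ++ s) : a = b ∧ r = s := by
  induction n with
  | zero => exact ⟨Subsingleton.elim _ _, by simpa [vecCode] using h⟩
  | succ n ih =>
    simp only [vecCode, List.ofFn_succ, List.flatMap_cons, List.append_assoc] at h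
    obtain ⟨h₀, h'⟩ := ratCode_append h
    obtain ⟨h₁, h₂⟩ := ih (a := fun i => a i.succ) (b := fun i => b i.succ) h'
    refine ⟨funext fun i => ?_, h₂⟩
    cases i using Fin.cases with
    | zero => exact h₀
    | succ i => exact congrFun h₁ i

theorem NodeCond.code_append {n : ℕ} {φ χ : NodeCond n} {r s : List ℕ}
    (h : φ.code ++ r = χ.code ++ s) : φ = χ ∧ r = s := by
  induction φ generalizing χ r s with
  | le a b c =>
    cases χ <;> simp [NodeCond.code] at h
    obtain ⟨rfl, h₁⟩ := vecCode_append h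
    obtain ⟨rfl, h₂⟩ := vecCode_append h₁
    obtain ⟨rfl, h₃⟩ := ratCode_append h₂
    exact ⟨rfl, h₃⟩
  | and φ₁ φ₂ ih₁ ih₂ =>
    cases χ <;> simp [NodeCond.code] at h
    obtain ⟨rfl, h₁⟩ := ih₁ h
    obtain ⟨rfl, h₂⟩ := ih₂ h₁
    exact ⟨rfl, h₂⟩
  | or φ₁ φ₂ ih₁ ih₂ =>
    cases χ <;> simp [NodeCond.code] at h
    obtain ⟨rfl, h₁⟩ := ih₁ h
    obtain ⟨rfl, h₂⟩ := ih₂ h₁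
    exact ⟨rfl, h₂⟩

theorem GraphCond.code_append {n : ℕ} {ψ χ : GraphCond n} {r s : List ℕ}
    (h : ψ.code ++ r = χ.code ++ s) : ψ = χ ∧ r = s := by
  induction ψ generalizing χ r s with
  | le a c =>
    cases χ <;> simp [GraphCond.code] at h
    obtain ⟨rfl, h₁⟩ := vecCode_append h
    obtain ⟨rfl, h₂⟩ := ratCode_append h₁
    exact ⟨rfl, h₂⟩
  | and ψ₁ ψ₂ ih₁ ih₂ =>
    cases χ <;> simp [GraphCond.code] at h
    obtain ⟨rfl, h₁⟩ := ih₁ h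
    obtain ⟨rfl, h₂⟩ := ih₂ h₁
    exact ⟨rfl, h₂⟩

/-- Different programs are represented by different words. -/
theorem Program.code_injective : Function.Injective Program.code := by
  rintro ⟨n, ψ, φ⟩ ⟨m, ψ', φ'⟩ h
  simp only [Program.code, List.cons.injEq] at h
  obtain ⟨rfl, h⟩ := h
  obtain ⟨rfl, h⟩ := GraphCond.code_append h
  obtain ⟨rfl, -⟩ := NodeCond.code_append (r := []) (s := []) (by simpa using h)
  rfl

/-! ### Decidability -/

/-- The problem `p` on objects that are represented by words is decidable: some total recursive
function gives the correct answer on the word of every object.  (No condition is put on its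
answers on words that represent no object.) -/
def IsDecidable {α : Type} (code : α → List ℕ) (p : α → Prop) : Prop :=
  ∃ f : List ℕ → Bool, Computable f ∧ ∀ x, f (code x) = true ↔ p x

end GLP

/-! The halting problem reduces to GLP, with finite derivation trees as the intermediate step. A
relation is `Definable` if its vectors are linked, by a positive Boolean combination of rational
linear inequalities, to root vectors of finite binary trees whose leaves and inner nodes obey rules
of the same kind (`LinDef`, `Der`). Two such systems merge into one when a tag records the kind of
each node; hence definable relations are closed under joins with linear conditions and under
reachability along a definable step (`Definable.join`, `Definable.reflTransGen`). This covers
composition, primitive recursion and minimisation, so the domain of every partial recursive function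
is definable (`exists_definable_dom`).

A node condition can check one inference of a tree provided that the neighbour sum shows the two
children separately. Therefore each node has a colour and writes its data into the block of
coordinates reserved for that colour, with zeros in all other blocks. An indicator sum equal to 1
then means that exactly one neighbour has the colour, and the sums over the block are the data of
that neighbour. Ranks that drop by at least 1 towards the children exclude circular derivations.
Both directions are `exists_entry_der_of_local` and `exists_graph_of_entry_der`. The graph condition
is needed only to demand a root. -/

namespace GLP

/-! ### Predicates built from rational linear inequalities -/

/-- Predicates on real vectors that are positive Boolean combinations of rational linear
inequalities. -/
inductive LinDef {ι : Type} [Fintype ι] : ((ι → ℝ) → Prop) → Prop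
  | ineq (a : ι → ℚ) (c : ℚ) : LinDef fun x => ∑ i, (a i : ℝ) * x i ≤ (c : ℝ)
  | and {p q : (ι → ℝ) → Prop} : LinDef p → LinDef q → LinDef fun x => p x ∧ q x
  | or {p q : (ι → ℝ) → Prop} : LinDef p → LinDef q → LinDef fun x => p x ∨ q x

/-- Affine functions with rational coefficients. -/
def IsRatAffine {ι : Type} [Fintype ι] (f : (ι → ℝ) → ℝ) : Prop :=
  ∃ (a : ι → ℚ) (c : ℚ), ∀ x, f x = ∑ i, (a i : ℝ) * x i + (c : ℝ)

section
variable {ι κ : Type} [Fintype ι] [Fintype κ]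

theorem IsRatAffine.const (c : ℚ) : IsRatAffine fun _ : ι → ℝ => (c : ℝ) :=
  ⟨0, c, fun x => by simp⟩

theorem IsRatAffine.coord (i : ι) : IsRatAffine fun x : ι → ℝ => x i := by
  classical
  refine ⟨Pi.single i 1, 0, fun x => ?_⟩
  rw [Finset.sum_eq_single i] <;> simp +contextual

theorem IsRatAffine.add {f g : (ι → ℝ) → ℝ} (hf : IsRatAffine f) (hg : IsRatAffine g) :
    IsRatAffine fun x => f x + g x := by
  obtain ⟨a, c, hf⟩ := hf
  obtain ⟨b, d, hg⟩ := hg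
  refine ⟨a + b, c + d, fun x => ?_⟩
  simp only [hf, hg, Pi.add_apply, Rat.cast_add, add_mul, Finset.sum_add_distrib]
  ring

theorem LinDef.le {f g : (ι → ℝ) → ℝ} (hf : IsRatAffine f) (hg : IsRatAffine g) :
    LinDef fun x => f x ≤ g x := by
  obtain ⟨a, c, hf⟩ := hf
  obtain ⟨b, d, hg⟩ := hg
  convert LinDef.ineq (a - b) (d - c) using 2 with x
  simp only [hf, hg, Pi.sub_apply, Rat.cast_sub, sub_mul, Finset.sum_sub_distrib]
  constructor <;> intro h <;> linarith

theorem LinDef.eq {f g : (ι → ℝ) → ℝ} (hf : IsRatAffine f) (hg : IsRatAffine g) :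
    LinDef fun x => f x = g x := by
  simpa only [le_antisymm_iff] using (LinDef.le hf hg).and (LinDef.le hg hf)

theorem LinDef.coord_eq_const (i : ι) (c : ℚ) : LinDef fun x : ι → ℝ => x i = (c : ℝ) :=
  .eq (.coord i) (.const c)

theorem LinDef.coord_eq_zero (i : ι) : LinDef fun x : ι → ℝ => x i = 0 := by
  simpa using LinDef.coord_eq_const i 0

theorem LinDef.coord_eq_one (i : ι) : LinDef fun x : ι → ℝ => x i = 1 := by
  simpa using LinDef.coord_eq_const i 1

theorem LinDef.coord_eq_two (i : ι) : LinDef fun x : ι → ℝ => x i = 2 := by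
  simpa using LinDef.coord_eq_const i 2

theorem LinDef.one_le_coord (i : ι) : LinDef fun x : ι → ℝ => 1 ≤ x i := by
  simpa using LinDef.le (IsRatAffine.const 1) (IsRatAffine.coord i)

theorem LinDef.coord_eq_coord (i j : ι) : LinDef fun x : ι → ℝ => x i = x j :=
  .eq (.coord i) (.coord j)

theorem LinDef.coord_eq_coord_add_one (i j : ι) : LinDef fun x : ι → ℝ => x i = x j + 1 := by
  simpa using LinDef.eq (.coord i) ((IsRatAffine.coord j).add (.const 1))

theorem LinDef.coord_add_one_le_coord (i j : ι) : LinDef fun x : ι → ℝ => x i + 1 ≤ x j := by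
  simpa using LinDef.le ((IsRatAffine.coord i).add (.const 1)) (.coord j)

theorem LinDef.true : LinDef fun _ : ι → ℝ => True := by
  simpa using LinDef.ineq (0 : ι → ℚ) 0

theorem LinDef.false : LinDef fun _ : ι → ℝ => False := by
  have : ¬ (0 : ℝ) ≤ -1 := by norm_num
  simpa [this] using LinDef.ineq (0 : ι → ℚ) (-1)

theorem LinDef.finset_forall {σ : Type} (s : Finset σ) {p : σ → (ι → ℝ) → Prop}
    (h : ∀ j, LinDef (p j)) : LinDef fun x => ∀ j ∈ s, p j x := by
  classical
  induction s using Finset.induction_on with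
  | empty => simpa using LinDef.true
  | insert j s _ ih => simpa using (h j).and ih

theorem LinDef.finset_exists {σ : Type} (s : Finset σ) {p : σ → (ι → ℝ) → Prop}
    (h : ∀ j, LinDef (p j)) : LinDef fun x => ∃ j ∈ s, p j x := by
  classical
  induction s using Finset.induction_on with
  | empty => simpa using LinDef.false
  | insert j s _ ih => simpa using (h j).or ih

theorem LinDef.forall {σ : Type} [Fintype σ] {p : σ → (ι → ℝ) → Prop}
    (h : ∀ j, LinDef (p j)) : LinDef fun x => ∀ j, p j x := by
  simpa using LinDef.finset_forall Finset.univ h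

theorem LinDef.exists {σ : Type} [Fintype σ] {p : σ → (ι → ℝ) → Prop}
    (h : ∀ j, LinDef (p j)) : LinDef fun x => ∃ j, p j x := by
  simpa using LinDef.finset_exists Finset.univ h

theorem LinDef.coords_eq_coords {σ : Type} [Fintype σ] (f g : σ → ι) :
    LinDef fun x : ι → ℝ => (fun j => x (f j)) = fun j => x (g j) := by
  simpa only [funext_iff] using LinDef.forall fun j => LinDef.coord_eq_coord (f j) (g j)

/-- Coefficients are added up over the fibres of `f`. Since `f` need not be injective, this covers
renaming, adding and identifying variables. -/
theorem LinDef.comap {p : (ι → ℝ) → Prop} (h : LinDef p) (f : ι → κ) :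
    LinDef fun x : κ → ℝ => p fun i => x (f i) := by
  classical
  induction h with
  | ineq a c =>
    convert LinDef.ineq (fun k => ∑ i with f i = k, a i) c using 3 with x
    rw [← Finset.sum_fiberwise Finset.univ f]
    refine Finset.sum_congr rfl fun k _ => ?_
    rw [Rat.cast_sum, Finset.sum_mul]
    refine Finset.sum_congr rfl fun i hi => ?_
    rw [← (Finset.mem_filter.1 hi).2]
  | and _ _ ih₁ ih₂ => exact ih₁.and ih₂
  | or _ _ ih₁ ih₂ => exact ih₁.or ih₂

end

end GLP
namespace GLP

/-! ### Relations defined by finite derivation trees with linear side conditions -/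

/-- Vectors that are derivable by a binary derivation tree: leaves satisfy `leaf`, and an inner node
and its two children satisfy `node`. -/
inductive Der {ι : Type} (leaf : (ι → ℝ) → Prop) (node : (ι → ℝ) → (ι → ℝ) → (ι → ℝ) → Prop) :
    (ι → ℝ) → Prop
  | leaf {x} : leaf x → Der leaf node x
  | node {x y z} : node x y z → Der leaf node y → Der leaf node z → Der leaf node x

/-- Binary relations between vectors that are given by linear inequalities. -/
abbrev LinDef₂ {ι κ : Type} [Fintype ι] [Fintype κ] (p : (ι → ℝ) → (κ → ℝ) → Prop) : Prop :=
  LinDef fun w : ι ⊕ κ → ℝ => p (fun i => w (Sum.inl i)) (fun i => w (Sum.inr i))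

/-- Ternary relations between vectors that are given by linear inequalities. -/
abbrev LinDef₃ {ι κ μ : Type} [Fintype ι] [Fintype κ] [Fintype μ]
    (p : (ι → ℝ) → (κ → ℝ) → (μ → ℝ) → Prop) : Prop :=
  LinDef fun w : ι ⊕ κ ⊕ μ → ℝ =>
    p (fun i => w (Sum.inl i)) (fun i => w (Sum.inr (Sum.inl i))) (fun i => w (Sum.inr (Sum.inr i)))

theorem LinDef₂.comap {ι κ σ : Type} [Fintype ι] [Fintype κ] [Fintype σ]
    {p : (ι → ℝ) → (κ → ℝ) → Prop} (h : LinDef₂ p) (f : ι → σ) (g : κ → σ) :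
    LinDef fun w : σ → ℝ => p (fun i => w (f i)) (fun i => w (g i)) :=
  LinDef.comap h (Sum.elim f g)

theorem LinDef₃.comap {ι κ μ σ : Type} [Fintype ι] [Fintype κ] [Fintype μ] [Fintype σ]
    {p : (ι → ℝ) → (κ → ℝ) → (μ → ℝ) → Prop} (h : LinDef₃ p) (f : ι → σ) (g : κ → σ) (k : μ → σ) :
    LinDef fun w : σ → ℝ => p (fun i => w (f i)) (fun i => w (g i)) (fun i => w (k i)) :=
  LinDef.comap h (Sum.elim f (Sum.elim g k))

/-- Relations defined by a derivation system. -/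
def Definable {α : Type} [Fintype α] (R : (α → ℝ) → Prop) : Prop :=
  ∃ (ι : Type) (_ : Fintype ι) (leaf : (ι → ℝ) → Prop)
    (node : (ι → ℝ) → (ι → ℝ) → (ι → ℝ) → Prop) (entry : (α → ℝ) → (ι → ℝ) → Prop),
    LinDef leaf ∧ LinDef₃ node ∧ LinDef₂ entry ∧ ∀ x, R x ↔ ∃ w, entry x w ∧ Der leaf node w

/-- The coordinates of a system with a new kind of nodes, with coordinates in `δ`, on top of two
given systems. The first coordinate tells the kind of a node. -/
abbrev SumCoord (δ ι κ : Type) : Type := Unit ⊕ δ ⊕ ι ⊕ κ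

/-! ### Merging two derivation systems -/

namespace SumCoord
variable {δ ι κ : Type}

/-- The kind of a node. -/
abbrev tag : SumCoord δ ι κ := Sum.inl ()
/-- The new coordinates. -/
abbrev new (i : δ) : SumCoord δ ι κ := Sum.inr (Sum.inl i)
/-- The coordinates of the first system. -/
abbrev fst (i : ι) : SumCoord δ ι κ := Sum.inr (Sum.inr (Sum.inl i))
/-- The coordinates of the second system. -/
abbrev snd (i : κ) : SumCoord δ ι κ := Sum.inr (Sum.inr (Sum.inr i))

/-- A vector with given parts. -/
def vec (t : ℝ) (d : δ → ℝ) (x : ι → ℝ) (y : κ → ℝ) : SumCoord δ ι κ → ℝ :=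
  Sum.elim (fun _ => t) (Sum.elim d (Sum.elim x y))

/-- The leaf condition of the combined system. -/
def leaf (l₁ : (ι → ℝ) → Prop) (l₂ : (κ → ℝ) → Prop) (w : SumCoord δ ι κ → ℝ) : Prop :=
  (w tag = 1 ∧ l₁ fun i => w (fst i)) ∨ (w tag = 2 ∧ l₂ fun i => w (snd i))

/-- The node condition of the combined system. -/
def node (n₀ : (δ → ℝ) → (SumCoord δ ι κ → ℝ) → (SumCoord δ ι κ → ℝ) → Prop)
    (n₁ : (ι → ℝ) → (ι → ℝ) → (ι → ℝ) → Prop) (n₂ : (κ → ℝ) → (κ → ℝ) → (κ → ℝ) → Prop)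
    (w u v : SumCoord δ ι κ → ℝ) : Prop :=
  (w tag = 0 ∧ n₀ (fun i => w (new i)) u v) ∨
  ((w tag = 1 ∧ u tag = 1 ∧ v tag = 1) ∧
    n₁ (fun i => w (fst i)) (fun i => u (fst i)) (fun i => v (fst i))) ∨
  ((w tag = 2 ∧ u tag = 2 ∧ v tag = 2) ∧
    n₂ (fun i => w (snd i)) (fun i => u (snd i)) (fun i => v (snd i)))

variable {l₁ : (ι → ℝ) → Prop} {l₂ : (κ → ℝ) → Prop}
  {n₀ : (δ → ℝ) → (SumCoord δ ι κ → ℝ) → (SumCoord δ ι κ → ℝ) → Prop}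
  {n₁ : (ι → ℝ) → (ι → ℝ) → (ι → ℝ) → Prop} {n₂ : (κ → ℝ) → (κ → ℝ) → (κ → ℝ) → Prop}

/-- Children of a node with tag 1 again have tag 1, so the whole tree below it uses only rules of
the first system. -/
theorem der_fst {w : SumCoord δ ι κ → ℝ} (h : Der (leaf l₁ l₂) (node n₀ n₁ n₂) w)
    (hw : w tag = 1) : Der l₁ n₁ fun i => w (fst i) := by
  induction h with
  | leaf h =>
    rcases h with ⟨_, h⟩ | ⟨h, _⟩
    · exact .leaf h
    · norm_num [hw] at h
  | node h _ _ ihu ihv =>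
    rcases h with ⟨h, _⟩ | ⟨⟨_, hu, hv⟩, h⟩ | ⟨⟨h, _⟩, _⟩
    · norm_num [hw] at h
    · exact .node h (ihu hu) (ihv hv)
    · norm_num [hw] at h

theorem der_snd {w : SumCoord δ ι κ → ℝ} (h : Der (leaf l₁ l₂) (node n₀ n₁ n₂) w)
    (hw : w tag = 2) : Der l₂ n₂ fun i => w (snd i) := by
  induction h with
  | leaf h =>
    rcases h with ⟨h, _⟩ | ⟨_, h⟩
    · norm_num [hw] at h
    · exact .leaf h
  | node h _ _ ihu ihv =>
    rcases h with ⟨h, _⟩ | ⟨⟨h, _⟩, _⟩ | ⟨⟨_, hu, hv⟩, h⟩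
    · norm_num [hw] at h
    · norm_num [hw] at h
    · exact .node h (ihu hu) (ihv hv)

/-- The rules for tag 1 ignore the remaining coordinates, so these can be padded by the same `d` and
`y` throughout the tree. -/
theorem der_vec_fst {x : ι → ℝ} (h : Der l₁ n₁ x) (d : δ → ℝ) (y : κ → ℝ) :
    Der (leaf l₁ l₂) (node n₀ n₁ n₂) (vec 1 d x y) := by
  induction h with
  | leaf h => exact .leaf (Or.inl ⟨rfl, h⟩)
  | node h _ _ ihu ihv =>
    refine .node ?_ ihu ihv
    exact Or.inr (Or.inl ⟨⟨rfl, rfl, rfl⟩, h⟩)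

theorem der_vec_snd {y : κ → ℝ} (h : Der l₂ n₂ y) (d : δ → ℝ) (x : ι → ℝ) :
    Der (leaf l₁ l₂) (node n₀ n₁ n₂) (vec 2 d x y) := by
  induction h with
  | leaf h => exact .leaf (Or.inr ⟨rfl, h⟩)
  | node h _ _ ihu ihv =>
    refine .node ?_ ihu ihv
    exact Or.inr (Or.inr ⟨⟨rfl, rfl, rfl⟩, h⟩)

theorem linDef_leaf [Fintype δ] [Fintype ι] [Fintype κ] (h₁ : LinDef l₁) (h₂ : LinDef l₂) :
    LinDef (leaf (δ := δ) l₁ l₂) :=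
  .or (.and (.coord_eq_one _) (h₁.comap fst)) (.and (.coord_eq_two _) (h₂.comap snd))

theorem linDef_node [Fintype δ] [Fintype ι] [Fintype κ] (h₀ : LinDef₃ n₀) (h₁ : LinDef₃ n₁)
    (h₂ : LinDef₃ n₂) : LinDef₃ (node n₀ n₁ n₂) :=
  .or (.and (.coord_eq_zero _)
      (h₀.comap (fun i => Sum.inl (new i)) (fun i => Sum.inr (Sum.inl i))
        (fun i => Sum.inr (Sum.inr i)))) <|
  .or (.and (.and (.coord_eq_one _) (.and (.coord_eq_one _) (.coord_eq_one _)))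
      (h₁.comap (fun i => Sum.inl (fst i)) (fun i => Sum.inr (Sum.inl (fst i)))
        (fun i => Sum.inr (Sum.inr (fst i))))) <|
  .and (.and (.coord_eq_two _) (.and (.coord_eq_two _) (.coord_eq_two _)))
      (h₂.comap (fun i => Sum.inl (snd i)) (fun i => Sum.inr (Sum.inl (snd i)))
        (fun i => Sum.inr (Sum.inr (snd i))))

end SumCoord

/-! ### Closure properties of definable relations -/

section
variable {α β γ : Type} [Fintype α] [Fintype β] [Fintype γ]

theorem Definable.of_linDef {R : (α → ℝ) → Prop} (h : LinDef R) : Definable R :=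
  ⟨α, inferInstance, R, fun _ _ _ => False, fun x w => w = x, h, LinDef.false,
    LinDef.coords_eq_coords Sum.inr Sum.inl, fun x => by
      constructor
      · exact fun h => ⟨x, rfl, .leaf h⟩
      · rintro ⟨_, rfl, h⟩
        cases h with
        | leaf h => exact h
        | node h => exact h.elim⟩

open SumCoord in
-- One new node with tag 0 is placed on top of a derivation for `A` and one for `B`. It stores `a`
-- and `b` besides `x`, because the entry relations need not determine them from the vectors of the
-- children.
theorem Definable.join {A : (α → ℝ) → Prop} {B : (β → ℝ) → Prop}
    {N : (γ → ℝ) → (α → ℝ) → (β → ℝ) → Prop} (hA : Definable A) (hB : Definable B)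
    (hN : LinDef₃ N) : Definable fun x => ∃ a b, N x a b ∧ A a ∧ B b := by
  obtain ⟨ι, _, l₁, n₁, e₁, hl₁, hn₁, he₁, hA⟩ := hA
  obtain ⟨κ, _, l₂, n₂, e₂, hl₂, hn₂, he₂, hB⟩ := hB
  let n₀ : (γ ⊕ α ⊕ β → ℝ) → (SumCoord (γ ⊕ α ⊕ β) ι κ → ℝ) →
      (SumCoord (γ ⊕ α ⊕ β) ι κ → ℝ) → Prop := fun d u v =>
    N (fun i => d (Sum.inl i)) (fun i => d (Sum.inr (Sum.inl i)))
      (fun i => d (Sum.inr (Sum.inr i))) ∧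
      (u tag = 1 ∧ e₁ (fun i => d (Sum.inr (Sum.inl i))) fun i => u (fst i)) ∧
      (v tag = 2 ∧ e₂ (fun i => d (Sum.inr (Sum.inr i))) fun i => v (snd i))
  have hn₀ : LinDef₃ n₀ :=
    .and (hN.comap (fun i => Sum.inl (Sum.inl i)) (fun i => Sum.inl (Sum.inr (Sum.inl i)))
        (fun i => Sum.inl (Sum.inr (Sum.inr i)))) <|
    .and (.and (.coord_eq_one _)
        (he₁.comap (fun i => Sum.inl (Sum.inr (Sum.inl i))) (fun i => Sum.inr (Sum.inl (fst i)))))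
      (.and (.coord_eq_two _)
        (he₂.comap (fun i => Sum.inl (Sum.inr (Sum.inr i))) (fun i => Sum.inr (Sum.inr (snd i)))))
  refine ⟨SumCoord (γ ⊕ α ⊕ β) ι κ, inferInstance, leaf l₁ l₂, node n₀ n₁ n₂,
    fun x w => w tag = 0 ∧ x = fun i => w (new (Sum.inl i)), linDef_leaf hl₁ hl₂,
    linDef_node hn₀ hn₁ hn₂, .and (.coord_eq_zero _) (.coords_eq_coords _ _), fun x => ?_⟩
  constructor
  · rintro ⟨a, b, hN, ha, hb⟩
    obtain ⟨w₁, he₁, hw₁⟩ := (hA a).1 ha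
    obtain ⟨w₂, he₂, hw₂⟩ := (hB b).1 hb
    refine ⟨vec 0 (Sum.elim x (Sum.elim a b)) 0 0, ⟨rfl, rfl⟩, .node (Or.inl ⟨rfl, ?_⟩)
      (der_vec_fst hw₁ 0 0) (der_vec_snd hw₂ 0 0)⟩
    exact ⟨hN, ⟨rfl, he₁⟩, ⟨rfl, he₂⟩⟩
  · rintro ⟨w, ⟨ht, rfl⟩, hw⟩
    cases hw with
    | leaf h => rcases h with ⟨h, _⟩ | ⟨h, _⟩ <;> norm_num [ht] at h
    | node h hu hv =>
      rcases h with ⟨_, hN, ⟨hu', he₁⟩, ⟨hv', he₂⟩⟩ | ⟨⟨h, _⟩, _⟩ | ⟨⟨h, _⟩, _⟩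
      · exact ⟨_, _, hN, (hA _).2 ⟨_, he₁, der_fst hu hu'⟩, (hB _).2 ⟨_, he₂, der_snd hv hv'⟩⟩
      all_goals norm_num [ht] at h

open SumCoord in
-- A path becomes a spine of nodes with tag 0. The first child of a spine node is the next state,
-- and the second child derives the step to it. Finiteness of derivations makes the path finite.
theorem Definable.reflTransGen {B : (γ → ℝ) → Prop} {T : (γ → ℝ) → (γ → ℝ) → Prop}
    (hB : Definable B)
    (hT : Definable fun w : γ ⊕ γ → ℝ => T (fun i => w (Sum.inl i)) fun i => w (Sum.inr i)) :
    Definable fun x => ∃ y, Relation.ReflTransGen T x y ∧ B y := by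
  obtain ⟨ι, _, l₁, n₁, e₁, hl₁, hn₁, he₁, hB⟩ := hB
  obtain ⟨κ, _, l₂, n₂, e₂, hl₂, hn₂, he₂, hT⟩ := hT
  -- The first alternative ends the path with a derivation for `B`, leaving the second child
  -- unconstrained; the other one takes a step to the state stored in the first child.
  let n₀ : (γ → ℝ) → (SumCoord γ ι κ → ℝ) → (SumCoord γ ι κ → ℝ) → Prop := fun d u v =>
    (u tag = 1 ∧ e₁ d fun i => u (fst i)) ∨
      ((u tag = 0 ∧ v tag = 2) ∧
        e₂ (fun i => Sum.elim d (fun i => u (new i)) i) fun i => v (snd i))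
  have hn₀ : LinDef₃ n₀ := by
    refine .or (.and (.coord_eq_one _) (he₁.comap Sum.inl (fun i => Sum.inr (Sum.inl (fst i)))))
      (.and (.and (.coord_eq_zero _) (.coord_eq_two _)) ?_)
    convert he₂.comap (σ := γ ⊕ SumCoord γ ι κ ⊕ SumCoord γ ι κ)
      (Sum.elim Sum.inl fun i => Sum.inr (Sum.inl (new i))) (fun i => Sum.inr (Sum.inr (snd i)))
      using 3 with w
    ext (i | i) <;> rfl
  have hT' : ∀ x y, T x y ↔ ∃ w, e₂ (Sum.elim x y) w ∧ Der l₂ n₂ w := fun x y => hT (Sum.elim x y)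
  refine ⟨SumCoord γ ι κ, inferInstance, leaf l₁ l₂, node n₀ n₁ n₂,
    fun x w => w tag = 0 ∧ x = fun i => w (new i), linDef_leaf hl₁ hl₂,
    linDef_node hn₀ hn₁ hn₂, .and (.coord_eq_zero _) (.coords_eq_coords _ _), fun x => ?_⟩
  constructor
  · rintro ⟨y, hxy, hy⟩
    refine ⟨vec 0 x 0 0, ⟨rfl, rfl⟩, ?_⟩
    induction hxy using Relation.ReflTransGen.head_induction_on with
    | refl =>
      obtain ⟨w, he, hw⟩ := (hB y).1 hy
      refine .node ?_ (der_vec_fst hw 0 0) (der_vec_fst hw 0 0)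
      exact Or.inl ⟨rfl, Or.inl ⟨rfl, he⟩⟩
    | head h _ ih =>
      obtain ⟨w, he, hw⟩ := (hT' _ _).1 h
      refine .node ?_ ih (der_vec_snd hw 0 0)
      exact Or.inl ⟨rfl, Or.inr ⟨⟨rfl, rfl⟩, he⟩⟩
  · rintro ⟨w, ⟨ht, rfl⟩, hw⟩
    induction hw with
    | leaf h => rcases h with ⟨h, _⟩ | ⟨h, _⟩ <;> norm_num [ht] at h
    | node h hu hv ihu _ =>
      rcases h with ⟨_, ⟨hu', he⟩ | ⟨⟨hu', hv'⟩, he⟩⟩ | ⟨⟨h, _⟩, _⟩ | ⟨⟨h, _⟩, _⟩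
      · exact ⟨_, .refl, (hB _).2 ⟨_, he, der_fst hu hu'⟩⟩
      · obtain ⟨y, hy, hBy⟩ := ihu hu'
        exact ⟨y, .head ((hT' _ _).2 ⟨_, he, der_snd hv hv'⟩) hy, hBy⟩
      all_goals norm_num [ht] at h

/-- A join needs two derivations, so `R` is joined with itself and the second copy is ignored. -/
theorem Definable.exists {R : (α ⊕ β → ℝ) → Prop} (h : Definable R) :
    Definable fun x : α → ℝ => ∃ y : β → ℝ, R (Sum.elim x y) := by
  have := h.join h (N := fun (x : α → ℝ) a _ => x = fun i => a (Sum.inl i)) (.coords_eq_coords _ _)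
  convert this using 2 with x
  constructor
  · rintro ⟨y, h⟩
    exact ⟨_, _, rfl, h, h⟩
  · rintro ⟨a, b, rfl, h, _⟩
    refine ⟨fun i => a (Sum.inr i), ?_⟩
    convert h
    ext (i | i) <;> rfl

theorem Definable.comap {R : (α → ℝ) → Prop} (h : Definable R) (f : α → β) :
    Definable fun x : β → ℝ => R fun i => x (f i) := by
  obtain ⟨ι, _, l, n, e, hl, hn, he, h⟩ := h
  exact ⟨ι, _, l, n, fun x w => e (fun i => x (f i)) w, hl, hn,
    he.comap (fun i => Sum.inl (f i)) Sum.inr, fun x => h _⟩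

theorem Definable.and {R S : (α → ℝ) → Prop} (hR : Definable R) (hS : Definable S) :
    Definable fun x => R x ∧ S x := by
  have := hR.join hS (N := fun (x : α → ℝ) a b => x = a ∧ x = b)
    (.and (.coords_eq_coords _ _) (.coords_eq_coords _ _))
  convert this using 2 with x
  constructor
  · rintro ⟨h, h'⟩
    exact ⟨_, _, ⟨rfl, rfl⟩, h, h'⟩
  · rintro ⟨a, b, ⟨rfl, rfl⟩, h, h'⟩
    exact ⟨h, h'⟩

theorem Definable.forall_fin {n : ℕ} {R : Fin n → (α → ℝ) → Prop} (h : ∀ i, Definable (R i)) :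
    Definable fun x => ∀ i, R i x := by
  induction n with
  | zero => simpa using Definable.of_linDef LinDef.true
  | succ n ih => simpa only [Fin.forall_fin_succ] using (h 0).and (ih fun i => h i.succ)

end

end GLP
namespace GLP

/-! ### Partial recursive functions have definable graphs -/

/-- A vector of natural numbers as a real vector. -/
def castVec {n : ℕ} (v : List.Vector ℕ n) : Fin n → ℝ := fun i => (v.get i : ℝ)

theorem castVec_cons {n : ℕ} (k : ℕ) (v : List.Vector ℕ n) :
    castVec (k ::ᵥ v) = Fin.cons (k : ℝ) (castVec v) := by
  ext i
  cases i using Fin.cases <;> simp [castVec]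

theorem castVec_ofFn {n : ℕ} (z : Fin n → ℕ) :
    castVec (List.Vector.ofFn z) = fun i => (z i : ℝ) := by
  ext i
  simp [castVec]

theorem apply_cons {n : ℕ} {σ τ : Type} (w : σ → τ) (a : σ) (b : Fin n → σ) :
    (fun i => w ((Fin.cons a b : Fin (n + 1) → σ) i)) =
      (Fin.cons (w a) fun i => w (b i) : Fin (n + 1) → τ) := by
  ext i
  cases i using Fin.cases <;> rfl

theorem cons_one {n : ℕ} (a : ℝ) (b : Fin (n + 1) → ℝ) :
    (Fin.cons a b : Fin (n + 2) → ℝ) 1 = b 0 := rfl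

theorem cons_cons_eta {n : ℕ} (x : Fin (n + 2) → ℝ) :
    x = Fin.cons (x 0) (Fin.cons (x 1) fun i => x i.succ.succ) := by
  ext i
  cases i using Fin.cases with
  | zero => rfl
  | succ i => cases i using Fin.cases <;> rfl

/-- The relation `R` between a value (coordinate `0`) and arguments is, for arguments that are
natural numbers, the graph of `f`. -/
def IsGraphOf {n : ℕ} (R : (Fin (n + 1) → ℝ) → Prop) (f : List.Vector ℕ n →. ℕ) : Prop :=
  ∀ y v, R (Fin.cons y (castVec v)) ↔ ∃ m ∈ f v, (m : ℝ) = y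

/-- Partial functions whose graph is definable. -/
def HasDefinableGraph {n : ℕ} (f : List.Vector ℕ n →. ℕ) : Prop :=
  ∃ R : (Fin (n + 1) → ℝ) → Prop, Definable R ∧ IsGraphOf R f

theorem mem_mOfFn {n : ℕ} {g : Fin n → Part ℕ} {v : List.Vector ℕ n} :
    v ∈ List.Vector.mOfFn g ↔ ∀ i, v.get i ∈ g i := by
  induction n with
  | zero => simpa [List.Vector.mOfFn] using v.eq_nil
  | succ n ih =>
    simp only [List.Vector.mOfFn, Part.bind_eq_bind, Part.pure_eq_some, Part.mem_bind_iff,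
      Part.mem_some_iff, ih, Fin.forall_fin_succ]
    constructor
    · rintro ⟨a, ha, w, hw, rfl⟩
      simpa using ⟨ha, hw⟩
    · rintro ⟨h₀, h⟩
      refine ⟨v.head, by simpa using h₀, v.tail, fun i => by simpa using h i, by simp⟩

/-- The intermediate values are guessed as reals; the graphs of the `g i` force them to be natural
numbers, which is where the graph of `f` is under control. -/
theorem HasDefinableGraph.comp {m n : ℕ} {f : List.Vector ℕ n →. ℕ}
    {g : Fin n → List.Vector ℕ m →. ℕ} (hf : HasDefinableGraph f)
    (hg : ∀ i, HasDefinableGraph (g i)) :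
    HasDefinableGraph fun v => (List.Vector.mOfFn fun i => g i v) >>= f := by
  obtain ⟨F, hF, hFf⟩ := hf
  choose G hG hGg using hg
  refine ⟨_, ((Definable.forall_fin fun i => (hG i).comap (β := Fin (m + 1) ⊕ Fin n)
    (Fin.cons (Sum.inr i) fun j => Sum.inl j.succ)).and
      (hF.comap (Fin.cons (Sum.inl 0) Sum.inr))).exists, fun y v => ?_⟩
  have hmem (b : ℕ) : b ∈ (List.Vector.mOfFn fun i => g i v) >>= f ↔
      ∃ w : List.Vector ℕ n, (∀ i, w.get i ∈ g i v) ∧ b ∈ f w :=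
    Part.mem_bind_iff.trans (by simp only [mem_mOfFn])
  simp only [apply_cons, Sum.elim_inl, Sum.elim_inr, hmem]
  constructor
  · rintro ⟨z, hz, hy⟩
    have h (i : Fin n) : ∃ k ∈ g i v, (k : ℝ) = z i := (hGg i _ _).1 (hz i)
    choose k hk hkz using h
    obtain rfl : castVec (List.Vector.ofFn k) = z := by
      rw [castVec_ofFn]
      exact funext hkz
    obtain ⟨b, hb, rfl⟩ := (hFf _ _).1 hy
    exact ⟨b, ⟨_, fun i => by simpa using hk i, hb⟩, rfl⟩
  · rintro ⟨b, ⟨w, hw, hb⟩, rfl⟩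
    exact ⟨castVec w, fun i => (hGg i _ _).2 ⟨_, hw i, rfl⟩, (hFf _ _).2 ⟨b, hb, rfl⟩⟩

/-- The states are triples of value, counter and parameters. A step lowers the counter by 1, guesses
the previous value and checks it against the present one through `G`; at counter 0 the value is
checked through `F`. -/
theorem HasDefinableGraph.prec {n : ℕ} {f : List.Vector ℕ n → ℕ} {g : List.Vector ℕ (n + 2) → ℕ}
    (hf : HasDefinableGraph (f : List.Vector ℕ n →. ℕ))
    (hg : HasDefinableGraph (g : List.Vector ℕ (n + 2) →. ℕ)) :
    HasDefinableGraph ((fun v : List.Vector ℕ (n + 1) =>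
      v.head.rec (f v.tail) fun y ih => g (y ::ᵥ ih ::ᵥ v.tail) : List.Vector ℕ (n + 1) → ℕ) :
        List.Vector ℕ (n + 1) →. ℕ) := by
  obtain ⟨F, hF, hFf⟩ := hf
  obtain ⟨G, hG, hGg⟩ := hg
  simp only [IsGraphOf, PFun.coe_val, Part.mem_some_iff, exists_eq_left] at hFf hGg
  let B : (Fin (n + 2) → ℝ) → Prop := fun x =>
    x 1 = 0 ∧ F fun i => x ((Fin.cons 0 fun i => i.succ.succ : Fin (n + 1) → Fin (n + 2)) i)
  let T : (Fin (n + 2) → ℝ) → (Fin (n + 2) → ℝ) → Prop := fun x x' =>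
    (1 ≤ x 1 ∧ x 1 = x' 1 + 1 ∧ (fun i : Fin n => x' i.succ.succ) = fun i => x i.succ.succ) ∧
      G (Fin.cons (x 0) (Fin.cons (x' 1) (Fin.cons (x' 0) fun i => x i.succ.succ)))
  have hB : Definable B := (Definable.of_linDef (.coord_eq_zero 1)).and (hF.comap _)
  have hT : Definable fun w : Fin (n + 2) ⊕ Fin (n + 2) → ℝ =>
      T (fun i => w (Sum.inl i)) fun i => w (Sum.inr i) := by
    refine (Definable.of_linDef (.and (.one_le_coord _) (.and (.coord_eq_coord_add_one _ _)
      (.coords_eq_coords _ _)))).and ?_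
    convert hG.comap (β := Fin (n + 2) ⊕ Fin (n + 2)) (Fin.cons (Sum.inl 0) (Fin.cons (Sum.inr 1)
      (Fin.cons (Sum.inr 0) fun i => Sum.inl i.succ.succ))) using 3 with w
    simp only [apply_cons]
  refine ⟨_, hB.reflTransGen hT, fun y v => ?_⟩
  simp only [PFun.coe_val, Part.mem_some_iff, exists_eq_left]
  have hB' (y : ℝ) (k : ℕ) (t : List.Vector ℕ n) :
      B (Fin.cons y (castVec (k ::ᵥ t))) ↔ k = 0 ∧ (f t : ℝ) = y := by
    rw [← hFf y t]
    simp only [B, apply_cons, castVec_cons]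
    simp
  constructor
  · rintro ⟨b, hb, hBb⟩
    generalize hx : (Fin.cons y (castVec v) : Fin (n + 2) → ℝ) = x at hb
    induction hb using Relation.ReflTransGen.head_induction_on generalizing y v with
    | refl =>
      subst hx
      obtain ⟨k, t, rfl⟩ := v.exists_eq_cons
      obtain ⟨rfl, h⟩ := (hB' _ _ _).1 hBb
      simpa using h
    | @head x x' h _ ih =>
      subst hx
      obtain ⟨k, t, rfl⟩ := v.exists_eq_cons
      obtain ⟨⟨h₁, h₂, h₃⟩, h₄⟩ := h
      simp only [castVec_cons, Fin.cons_zero, Fin.cons_succ, cons_one] at h₁ h₂ h₃ h₄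
      obtain _ | k := k
      · norm_num at h₁
      have hx' := cons_cons_eta x'
      have hk : x' 1 = k := by
        push_cast at h₂
        linarith
      rw [h₃, hk, ← castVec_cons] at hx'
      -- The guessed value must be known to be a natural number before `hGg` applies, since `G` is
      -- unspecified at other reals. The induction hypothesis provides this.
      have := ih _ _ hx'.symm
      rw [hk, ← this, ← castVec_cons] at h₄
      simp only [List.Vector.head_cons, List.Vector.tail_cons] at h₄ ⊢
      exact (hGg _ (k ::ᵥ _ ::ᵥ t)).1 (by rw [castVec_cons]; exact h₄)
  · rintro rfl
    obtain ⟨k, t, rfl⟩ := v.exists_eq_cons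
    simp only [List.Vector.head_cons, List.Vector.tail_cons]
    induction k with
    | zero => exact ⟨_, .refl, (hB' _ _ _).2 ⟨rfl, rfl⟩⟩
    | succ k ih =>
      obtain ⟨b, hb, hBb⟩ := ih
      refine ⟨b, .head ⟨?_, ?_⟩ hb, hBb⟩
      · simp [castVec_cons]
      · have := (hGg _ (k ::ᵥ (k.rec (f t) fun y ih => g (y ::ᵥ ih ::ᵥ t) : ℕ) ::ᵥ t)).2 rfl
        simpa only [castVec_cons, Fin.cons_zero, Fin.cons_succ, cons_one] using this

theorem HasDefinableGraph.of_primrec' {n : ℕ} {f : List.Vector ℕ n → ℕ} (h : Nat.Primrec' f) :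
    HasDefinableGraph (f : List.Vector ℕ n →. ℕ) := by
  induction h with
  | zero =>
    exact ⟨_, .of_linDef (.coord_eq_zero 0), fun y v => by simp [eq_comm]⟩
  | succ =>
    exact ⟨_, .of_linDef (.coord_eq_coord_add_one 0 1), fun y v => by
      simp [eq_comm, castVec]⟩
  | get i =>
    exact ⟨_, .of_linDef (.coord_eq_coord 0 i.succ), fun y v => by simp [eq_comm, castVec]⟩
  | comp g _ _ hf hg =>
    refine (congrArg HasDefinableGraph (funext fun v => ?_)).mp (hf.comp hg)
    simp only [PFun.coe_val, Vector.mOfFn_part_some]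
    exact Part.bind_some _ _
  | prec _ _ hf hg => exact hf.prec hg

/-- The result is guessed at the start and carried along while the candidate counts up from 0, until
both agree. That `f` is nonzero at a rejected candidate is expressible without negation, as a value
of at least 1. -/
theorem HasDefinableGraph.rfind {n : ℕ} {f : List.Vector ℕ (n + 1) → ℕ}
    (hf : HasDefinableGraph (f : List.Vector ℕ (n + 1) →. ℕ)) :
    HasDefinableGraph fun v => Nat.rfind fun n => Part.some (decide (f (n ::ᵥ v) = 0)) := by
  obtain ⟨F, hF, hFf⟩ := hf
  simp only [IsGraphOf, PFun.coe_val, Part.mem_some_iff, exists_eq_left] at hFf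
  -- coordinates: the result, the current candidate, the parameters
  let B : (Fin (n + 2) → ℝ) → Prop := fun x => x 0 = x 1 ∧
    ∃ u : Fin 1 → ℝ, u 0 = 0 ∧ F (Fin.cons (u 0) fun i => x i.succ)
  let T : (Fin (n + 2) → ℝ) → (Fin (n + 2) → ℝ) → Prop := fun x x' =>
    (x' 0 = x 0 ∧ x' 1 = x 1 + 1 ∧ (fun i : Fin n => x' i.succ.succ) = fun i => x i.succ.succ) ∧
      ∃ u : Fin 1 → ℝ, 1 ≤ u 0 ∧ F (Fin.cons (u 0) fun i => x i.succ)
  have hB : Definable B := by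
    refine (Definable.of_linDef (.coord_eq_coord 0 1)).and ?_
    convert ((Definable.of_linDef (.coord_eq_zero (Sum.inr 0))).and (hF.comap
      (β := Fin (n + 2) ⊕ Fin 1) (Fin.cons (Sum.inr 0) fun i => Sum.inl i.succ))).exists
      using 4 with w u
    simp only [apply_cons]
    rfl
  have hT : Definable fun w : Fin (n + 2) ⊕ Fin (n + 2) → ℝ =>
      T (fun i => w (Sum.inl i)) fun i => w (Sum.inr i) := by
    refine (Definable.of_linDef (.and (.coord_eq_coord _ _) (.and (.coord_eq_coord_add_one _ _)
      (.coords_eq_coords _ _)))).and ?_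
    convert ((Definable.of_linDef (.one_le_coord (Sum.inr 0))).and (hF.comap
      (β := (Fin (n + 2) ⊕ Fin (n + 2)) ⊕ Fin 1)
      (Fin.cons (Sum.inr 0) fun i => Sum.inl (Sum.inl i.succ)))).exists
      using 4 with w u
    simp only [apply_cons]
    rfl
  have hQ := ((Definable.of_linDef (.coord_eq_zero (Sum.inr 0))).and
    ((hB.reflTransGen hT).comap (β := Fin (n + 1) ⊕ Fin 1)
      (Fin.cons (Sum.inl 0) (Fin.cons (Sum.inr 0) fun i => Sum.inl i.succ)))).exists
  have hB' (y : ℝ) (k : ℕ) (v : List.Vector ℕ n) :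
      B (Fin.cons y (castVec (k ::ᵥ v))) ↔ y = k ∧ f (k ::ᵥ v) = 0 := by
    simp only [B, Fin.cons_zero, Fin.cons_succ, hFf, cons_one]
    simp only [castVec_cons, Fin.cons_zero]
    refine and_congr_right fun _ => ⟨?_, fun h => ⟨0, rfl, by simp [h]⟩⟩
    rintro ⟨u, hu, h⟩
    rw [hu] at h
    exact_mod_cast h
  have hT' (y : ℝ) (k : ℕ) (v : List.Vector ℕ n) (x') :
      T (Fin.cons y (castVec (k ::ᵥ v))) x' ↔
        x' = Fin.cons y (castVec ((k + 1) ::ᵥ v)) ∧ f (k ::ᵥ v) ≠ 0 := by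
    simp only [T, Fin.cons_zero, Fin.cons_succ, hFf]
    simp only [castVec_cons, Fin.cons_zero, Fin.cons_succ, cons_one]
    refine and_congr ⟨?_, ?_⟩ ⟨?_, fun h => ⟨fun _ => f (k ::ᵥ v), ?_, rfl⟩⟩
    · rintro ⟨h₀, h₁, h₂⟩
      rw [cons_cons_eta x', h₀, h₁, h₂]
      push_cast
      rfl
    · rintro rfl
      simp
    · rintro ⟨u, hu, h⟩ h0
      rw [← h, h0] at hu
      norm_num at hu
    · exact Nat.one_le_cast.2 (Nat.one_le_iff_ne_zero.2 h)
  have key (y : ℝ) (k : ℕ) (v : List.Vector ℕ n) :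
      (∃ b, Relation.ReflTransGen T (Fin.cons y (castVec (k ::ᵥ v))) b ∧ B b) ↔
        ∃ m : ℕ, y = m ∧ k ≤ m ∧ f (m ::ᵥ v) = 0 ∧ ∀ j, k ≤ j → j < m → f (j ::ᵥ v) ≠ 0 := by
    constructor
    · rintro ⟨b, hb, hBb⟩
      generalize hx : (Fin.cons y (castVec (k ::ᵥ v)) : Fin (n + 2) → ℝ) = x at hb
      induction hb using Relation.ReflTransGen.head_induction_on generalizing k with
      | refl =>
        subst hx
        obtain ⟨rfl, h⟩ := (hB' _ _ _).1 hBb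
        exact ⟨k, rfl, le_rfl, h, fun j _ _ => by omega⟩
      | head h _ ih =>
        subst hx
        obtain ⟨rfl, hk⟩ := (hT' _ _ _ _).1 h
        obtain ⟨m, hy, hkm, hm, hj⟩ := ih (k + 1) rfl
        refine ⟨m, hy, by omega, hm, fun j hkj hjm => ?_⟩
        obtain rfl | hlt := hkj.eq_or_lt
        · exact hk
        · exact hj j hlt hjm
    · rintro ⟨m, rfl, hkm, hm, hj⟩
      induction hkm using Nat.decreasingInduction with
      | self => exact ⟨_, .refl, (hB' _ _ _).2 ⟨rfl, hm⟩⟩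
      | of_succ k hk ih =>
        obtain ⟨b, hb, hBb⟩ := ih fun j h => hj j (by omega)
        exact ⟨b, .head ((hT' _ _ _ _).2 ⟨rfl, hj k le_rfl (by omega)⟩) hb, hBb⟩
  refine ⟨_, hQ, fun y v => ?_⟩
  simp only [apply_cons, Sum.elim_inl, Sum.elim_inr, Fin.cons_zero, Fin.cons_succ]
  have key₀ := key y 0 v
  simp only [castVec_cons, Nat.cast_zero] at key₀
  constructor
  · rintro ⟨u, hu, h⟩
    rw [hu] at h
    obtain ⟨m, rfl, _, hm, hj⟩ := key₀.1 h
    refine ⟨m, Nat.mem_rfind.2 ⟨by simpa using hm, fun {j} hjm => ?_⟩, rfl⟩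
    simpa using hj j (Nat.zero_le _) hjm
  · rintro ⟨m, hm, rfl⟩
    obtain ⟨hm, hj⟩ := Nat.mem_rfind.1 hm
    refine ⟨0, rfl, key₀.2 ⟨m, rfl, Nat.zero_le _, by simpa using hm, fun j _ hjm => ?_⟩⟩
    simpa using hj hjm

theorem HasDefinableGraph.of_partrec' {n : ℕ} {f : List.Vector ℕ n →. ℕ} (h : Nat.Partrec' f) :
    HasDefinableGraph f := by
  induction h with
  | prim h => exact .of_primrec' h
  | comp g _ _ hf hg => exact hf.comp hg
  | rfind _ hf => exact hf.rfind

/-- The domain of a partial recursive function is definable. -/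
theorem exists_definable_dom {f : ℕ →. ℕ} (hf : Partrec f) :
    ∃ R : (Fin 1 → ℝ) → Prop, Definable R ∧ ∀ n : ℕ, R (fun _ => n) ↔ (f n).Dom := by
  obtain ⟨F, hF, hFf⟩ := HasDefinableGraph.of_partrec' (Nat.Partrec'.part_iff₁.2 hf)
  refine ⟨_, (hF.comap (β := Fin 1 ⊕ Fin 1) (Fin.cons (Sum.inr 0) Sum.inl)).exists, fun n => ?_⟩
  simp only [apply_cons, Sum.elim_inl, Sum.elim_inr]
  have h (y : ℝ) := hFf y (n ::ᵥ .nil)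
  have hn : castVec (n ::ᵥ .nil) = fun _ => (n : ℝ) := by
    ext i
    simp [castVec, Subsingleton.elim i 0]
  simp only [hn, List.Vector.head_cons] at h
  simp only [h, Part.dom_iff_mem]
  constructor
  · rintro ⟨_, m, hm, _⟩
    exact ⟨m, hm⟩
  · rintro ⟨m, hm⟩
    exact ⟨fun _ => m, m, hm, rfl⟩

end GLP
namespace GLP

/-! ### Graphs that encode derivation trees -/

theorem LinDef.const_prop {ι : Type} [Fintype ι] (P : Prop) : LinDef fun _ : ι → ℝ => P := by
  by_cases h : P
  · simpa [h] using LinDef.true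
  · simpa [h] using LinDef.false

theorem LinDef.exists_nodeCond {n : ℕ} {p : (Fin n ⊕ Fin n → ℝ) → Prop} (h : LinDef p) :
    ∃ φ : NodeCond n, ∀ (G : LabeledGraph n) (v : G.V),
      φ.Holds G v ↔ p (Sum.elim (G.label v) (G.neighSum v)) := by
  induction h with
  | ineq a c =>
    exact ⟨.le (fun i => a (.inl i)) (fun i => a (.inr i)) c, fun G v => by
      simp [NodeCond.Holds, Finset.sum_add_distrib]⟩
  | and _ _ ih₁ ih₂ =>
    obtain ⟨φ₁, h₁⟩ := ih₁
    obtain ⟨φ₂, h₂⟩ := ih₂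
    exact ⟨.and φ₁ φ₂, fun G v => and_congr (h₁ G v) (h₂ G v)⟩
  | or _ _ ih₁ ih₂ =>
    obtain ⟨φ₁, h₁⟩ := ih₁
    obtain ⟨φ₂, h₂⟩ := ih₂
    exact ⟨.or φ₁ φ₂, fun G v => or_congr (h₁ G v) (h₂ G v)⟩

/-- The colour of a node of a derivation tree: its depth modulo `3`, and which child it is. The
children of a node are recognised among its neighbours by their colours. -/
abbrev Colour : Type := ZMod 3 × Bool

/-- The coordinates of the labels: the input, a flag that marks the root, and for every colour an
indicator, a rank, and the coordinates of a vector. -/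
abbrev TreeCoord (ι : Type) : Type := Bool ⊕ Colour × Option (Option ι)

namespace TreeCoord
variable {ι : Type}

/-- The coordinate that holds the input. -/
abbrev input : TreeCoord ι := .inl false
/-- The coordinate that marks the root. -/
abbrev root : TreeCoord ι := .inl true
/-- The coordinate that indicates the colour `c`. -/
abbrev ind (c : Colour) : TreeCoord ι := .inr (c, none)
/-- The coordinate that holds the rank of a node of colour `c`. -/
abbrev rank (c : Colour) : TreeCoord ι := .inr (c, some none)
/-- The coordinates that hold the vector at a node of colour `c`. -/
abbrev val (c : Colour) (i : ι) : TreeCoord ι := .inr (c, some (some i))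

/-- The local condition at a node with label `x` and sum `y` of the labels of its neighbours. -/
def Local (leaf : (ι → ℝ) → Prop) (node : (ι → ℝ) → (ι → ℝ) → (ι → ℝ) → Prop)
    (entry : (Fin 1 → ℝ) → (ι → ℝ) → Prop) (x y : TreeCoord ι → ℝ) : Prop :=
  ∃ c : Colour, (x (ind c) = 1 ∧ ∀ c', c' = c ∨ ∀ o, x (.inr (c', o)) = 0) ∧
    (x root = 0 ∨ entry (fun _ => x input) fun i => x (val c i)) ∧
    (leaf (fun i => x (val c i)) ∨
      (∀ b, y (ind (c.1 + 1, b)) = 1 ∧ y (rank (c.1 + 1, b)) + 1 ≤ x (rank c)) ∧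
      node (fun i => x (val c i)) (fun i => y (val (c.1 + 1, false) i))
        fun i => y (val (c.1 + 1, true) i))

theorem linDef_local [Fintype ι] {leaf : (ι → ℝ) → Prop}
    {node : (ι → ℝ) → (ι → ℝ) → (ι → ℝ) → Prop} {entry : (Fin 1 → ℝ) → (ι → ℝ) → Prop}
    (hl : LinDef leaf) (hn : LinDef₃ node) (he : LinDef₂ entry) :
    LinDef₂ (Local leaf node entry) := by
  refine .exists fun c => .and (.and (.coord_eq_one _) (.forall fun c' => .or (.const_prop _)
    (.forall fun o => .coord_eq_zero _))) (.and (.or (.coord_eq_zero _) ?_)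
    (.or ?_ (.and (.forall fun b => .and (.coord_eq_one _) (.coord_add_one_le_coord _ _)) ?_)))
  · exact he.comap (fun _ => Sum.inl input) (fun i => Sum.inl (val c i))
  · exact hl.comap (fun i => Sum.inl (val c i))
  · exact hn.comap (fun i => Sum.inl (val c i)) (fun i => Sum.inr (val (c.1 + 1, false) i))
      (fun i => Sum.inr (val (c.1 + 1, true) i))

end TreeCoord

/-! ### Derivations from locally correct graphs, and conversely -/

theorem LabeledGraph.neighSum_eq_label {n : ℕ} (G : LabeledGraph n) {v w : G.V} {i : Fin n}
    (hw : G.Adj v w) (h : ∀ u, G.Adj v u → u ≠ w → G.label u i = 0) :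
    G.neighSum v i = G.label w i := by
  classical
  refine Finset.sum_eq_single_of_mem w (by simpa using hw) fun u hu => h u ?_
  simpa using hu

/-- The indicator sum counts the elements of colour `c`, so there is exactly one; all others
contribute 0 to every coordinate `o`. -/
theorem exists_of_sum_indicator {V C O : Type} (A : Finset V) (col : V → C) (f : V → O → ℝ) (c : C)
    (o₀ : O) (h₁ : ∀ w, col w = c → f w o₀ = 1) (h₀ : ∀ w, col w ≠ c → ∀ o, f w o = 0)
    (hs : ∑ w ∈ A, f w o₀ = 1) :
    ∃ w₀ ∈ A, col w₀ = c ∧ ∀ o, ∑ w ∈ A, f w o = f w₀ o := by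
  classical
  have h (o : O) : ∑ w ∈ A, f w o = ∑ w ∈ A with col w = c, f w o :=
    (Finset.sum_filter_of_ne fun w _ hw => by_contra fun hc => hw (h₀ w hc o)).symm
  rw [h, Finset.sum_congr rfl fun w hw => h₁ w (Finset.mem_filter.1 hw).2] at hs
  obtain ⟨w₀, hw₀⟩ := Finset.card_eq_one.1 (by simpa using hs : Finset.card _ = 1)
  have hw := (hw₀ ▸ Finset.mem_singleton_self w₀ : w₀ ∈ A.filter fun w => col w = c)
  exact ⟨w₀, (Finset.mem_filter.1 hw).1, (Finset.mem_filter.1 hw).2, fun o => by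
    rw [h, hw₀, Finset.sum_singleton]⟩

section
variable {ι : Type} {leaf : (ι → ℝ) → Prop} {node : (ι → ℝ) → (ι → ℝ) → (ι → ℝ) → Prop}
  {entry : (Fin 1 → ℝ) → (ι → ℝ) → Prop} {N : ℕ} {e : TreeCoord ι → Fin N}

open TreeCoord

/-- The graph may contain cycles, so derivability is proved at all nodes by a counterexample of
least rank. The ranks are real, but the minimum exists because there are finitely many nodes. Its
children have smaller rank, hence are derivable, and so is the node itself. The positive root sum
supplies a node where `entry` holds. -/
theorem exists_entry_der_of_local (G : LabeledGraph N)
    (hG : ∀ v, Local leaf node entry (fun k => G.label v (e k)) fun k => G.neighSum v (e k))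
    {t : ℝ} (hinput : ∀ v, G.label v (e input) = t) (hroot : 1 ≤ G.totalSum (e root)) :
    ∃ w, entry (fun _ => t) w ∧ Der leaf node w := by
  choose col hcol hentry hstep using hG
  have hder (v : G.V) : Der leaf node fun i => G.label v (e (val (col v) i)) := by
    by_contra hv
    obtain ⟨u, hu, hmin⟩ := Set.exists_min_image
      {v : G.V | ¬ Der leaf node fun i => G.label v (e (val (col v) i))}
      (fun v => G.label v (e (rank (col v)))) (Set.toFinite _) ⟨v, hv⟩
    rcases hstep u with h | ⟨hch, h⟩
    · exact hu (.leaf h)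
    have hchild (b : Bool) : Der leaf node fun i =>
        G.neighSum u (e (val ((col u).1 + 1, b) i)) := by
      obtain ⟨h₁, h₂⟩ := hch b
      obtain ⟨w, _, hw, hsum⟩ := exists_of_sum_indicator _ col
        (fun w o => G.label w (e (.inr (((col u).1 + 1, b), o)))) _ none
        (fun w hw => hw ▸ (hcol w).1) (fun w hw => ((hcol w).2 _).resolve_left (Ne.symm hw)) h₁
      by_contra hd
      have hval (o) : G.neighSum u (e (.inr (((col u).1 + 1, b), o))) =
          G.label w (e (.inr (((col u).1 + 1, b), o))) := hsum o
      have := hmin w (by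
        simpa only [Set.mem_ofPred_eq, hw, val, hval] using hd)
      simp only [rank, hval] at h₂
      rw [hw] at this
      linarith
    exact hu (.node h (hchild false) (hchild true))
  obtain ⟨v, _, hv⟩ : ∃ v ∈ Finset.univ, G.label v (e root) ≠ 0 := by
    refine Finset.exists_ne_zero_of_sum_ne_zero (fun h => ?_)
    rw [LabeledGraph.totalSum, h] at hroot
    norm_num at hroot
  refine ⟨_, ?_, hder v⟩
  simpa only [hinput] using (hentry v).resolve_left hv

/-- A derivable vector is the vector at the root of a finite binary tree, here given with two child
functions and a rank that decreases from inner nodes to their children. -/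
theorem Der.exists_tree {x : ι → ℝ} (h : Der leaf node x) :
    ∃ (V : Type) (_ : Fintype V) (val : V → ι → ℝ) (rank : V → ℕ) (child : Bool → V → V) (r : V),
      val r = x ∧ ∀ v, leaf (val v) ∨ (∀ b, rank (child b v) + 1 ≤ rank v) ∧
        node (val v) (val (child false v)) (val (child true v)) := by
  induction h with
  | @leaf x h =>
    -- The child functions are total, so a leaf needs a dummy child; it is never inspected.
    exact ⟨Unit, inferInstance, fun _ => x, fun _ => 0, fun _ v => v, (), rfl, fun _ => .inl h⟩
  | @node x y z h _ _ ihy ihz =>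
    obtain ⟨V, _, val₁, rank₁, child₁, r₁, rfl, h₁⟩ := ihy
    obtain ⟨W, _, val₂, rank₂, child₂, r₂, rfl, h₂⟩ := ihz
    refine ⟨Option (V ⊕ W), inferInstance, fun v => v.elim x (Sum.elim val₁ val₂),
      fun v => v.elim (max (rank₁ r₁) (rank₂ r₂) + 1) (Sum.elim rank₁ rank₂),
      fun b v => some (v.elim (if b then .inr r₂ else .inl r₁)
        (Sum.map (child₁ b) (child₂ b))), none, rfl, ?_⟩
    rintro (_ | v | w)
    · refine .inr ⟨?_, by simpa using h⟩
      rintro (_ | _) <;> simp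
    · exact h₁ v
    · exact h₂ w

/-- Each tree vertex is copied once for every colour, and a copy is joined to the copies of its
children in the next phase. Thus no depths have to be computed, and the dummy children of leaves do
no harm. The six marked copies of the root are compatible with the root condition, which is only a
lower bound. -/
theorem exists_graph_of_entry_der (e : TreeCoord ι ≃ Fin N) {t : ℝ} {w : ι → ℝ}
    (hw : entry (fun _ => t) w) (h : Der leaf node w) :
    ∃ G : LabeledGraph N,
      (∀ v, Local leaf node entry (fun k => G.label v (e k)) fun k => G.neighSum v (e k)) ∧
      (∀ v, G.label v (e input) = t) ∧ 1 ≤ G.totalSum (e root) := by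
  classical
  obtain ⟨V, _, vec, rk, child, r, rfl, hV⟩ := h.exists_tree
  let attr (v : V) (o : Option (Option ι)) : ℝ := o.elim 1 fun o => o.elim (rk v : ℝ) (vec v)
  let lab (p : V × Colour) : TreeCoord ι → ℝ :=
    Sum.elim (fun b => if b then (if p.1 = r then 1 else 0) else t)
      fun q => if q.1 = p.2 then attr p.1 q.2 else 0
  let parent (p q : V × Colour) : Prop := q.2.1 = p.2.1 + 1 ∧ q.1 = child q.2.2 p.1
  let G : LabeledGraph N :=
    { V := V × Colour
      Adj := fun p q => parent p q ∨ parent q p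
      symm := fun p q h => h.symm
      label := fun p k => lab p (e.symm k) }
  have hlab (p : V × Colour) (k) : G.label p (e k) = lab p k := by simp [G]
  have hneigh (p : V × Colour) (b : Bool) (o) :
      G.neighSum p (e (.inr ((p.2.1 + 1, b), o))) = attr (child b p.1) o := by
    -- Edges are undirected. With three phases, a neighbour one phase ahead cannot be a parent,
    -- which is one phase behind; two phases would not separate them.
    have hphase (a : ZMod 3) : a ≠ a + 1 + 1 := by revert a; decide
    rw [G.neighSum_eq_label (w := (child b p.1, (p.2.1 + 1, b))) (.inl ⟨rfl, rfl⟩), hlab]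
    · simp [lab]
    · rintro ⟨v, c⟩ hq hne
      simp only [hlab, lab, Sum.elim_inr]
      split_ifs with hc
      · subst hc
        rcases hq with h | h
        · exact absurd (congrArg (·, _) h.2) hne
        · exact absurd h.1 (hphase _)
      · rfl
  refine ⟨G, fun p => ?_, fun p => by simp [hlab, lab], ?_⟩
  · refine ⟨p.2, ⟨by simp [hlab, lab, attr], fun c' => ?_⟩, ?_, ?_⟩
    · by_cases hc : c' = p.2
      · exact .inl hc
      · exact .inr fun o => by simp [hlab, lab, hc]
    · by_cases hp : p.1 = r
      · right
        simpa [hlab, lab, attr, hp] using hw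
      · left
        simp [hlab, lab, hp]
    · simp only [hneigh, hlab]
      refine (hV p.1).imp (fun h => ?_) fun h => ⟨fun b => ⟨rfl, ?_⟩, ?_⟩
      · simpa [lab, attr] using h
      · have := h.1 b
        simp only [attr, lab, Sum.elim_inr, if_true, Option.elim_some, Option.elim_none]
        exact_mod_cast this
      · simpa [lab, attr] using h.2
  · have : G.label (r, (0, true)) (e root) = 1 := by simp [hlab, lab]
    rw [← this]
    refine Finset.single_le_sum (f := fun v : G.V => G.label v (e root)) (fun p _ => ?_)
      (Finset.mem_univ ((r, (0, true)) : V × Colour))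
    simp only [hlab, lab, Sum.elim_inl, if_true]
    split_ifs <;> norm_num

end

/-! ### The reduction -/

/-- The program that says that `φ` holds at all nodes, coordinate `i` is `t` at all nodes, and the
sum of coordinate `j` is at least `1`. -/
def inputProgram {N : ℕ} (i j : Fin N) (φ : NodeCond N) (t : ℕ) : Program where
  n := N
  graphCond := .le (Pi.single j (-1)) (-1)
  nodeCond := .and (.le (Pi.single i 1) 0 (t : ℚ)) (.and (.le (Pi.single i (-1)) 0 (-(t : ℚ))) φ)

theorem inputProgram_satisfiable {N : ℕ} (i j : Fin N) (φ : NodeCond N) (t : ℕ) :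
    (inputProgram i j φ t).Satisfiable ↔ ∃ G : LabeledGraph N, (∀ v, φ.Holds G v) ∧
      (∀ v, G.label v i = t) ∧ 1 ≤ G.totalSum j := by
  have hsingle (k : Fin N) (c : ℚ) (x : Fin N → ℝ) :
      ∑ l, ((Pi.single k c : Fin N → ℚ) l : ℝ) * x l = (c : ℝ) * x k := by
    rw [Finset.sum_eq_single k] <;> simp +contextual
  refine exists_congr fun G => ?_
  simp only [inputProgram, GraphCond.Holds, NodeCond.Holds, hsingle, Pi.zero_apply, Rat.cast_zero,
    zero_mul, add_zero]
  push_cast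
  simp only [one_mul, neg_mul, neg_le_neg_iff]
  constructor
  · rintro ⟨h₁, h₂⟩
    exact ⟨fun v => (h₂ v).2.2, fun v => le_antisymm (h₂ v).1 (h₂ v).2.1, h₁⟩
  · rintro ⟨h₁, h₂, h₃⟩
    exact ⟨h₃, fun v => ⟨(h₂ v).le, (h₂ v).ge, h₁ v⟩⟩

/-- Only the codes `[t, 0, 1]` of `t` and `[0, t, 1]` of `-t` depend on the input, so `t` is
inserted at two places of a fixed word. -/
theorem inputProgram_code_computable {N : ℕ} (i j : Fin N) (φ : NodeCond N) :
    Computable fun t => (inputProgram i j φ t).code := by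
  obtain ⟨l₁, l₂, l₃, h⟩ : ∃ l₁ l₂ l₃ : List ℕ, ∀ t,
      (inputProgram i j φ t).code = l₁ ++ (t :: (l₂ ++ (t :: l₃))) := by
    refine ⟨N :: (GraphCond.code (.le (Pi.single j (-1)) (-1)) ++
      1 :: 0 :: (vecCode (Pi.single i 1 : Fin N → ℚ) ++ vecCode (0 : Fin N → ℚ))),
      0 :: 1 :: 1 :: 0 :: (vecCode (Pi.single i (-1) : Fin N → ℚ) ++
      (vecCode (0 : Fin N → ℚ) ++ [0])), 1 :: φ.code, fun t => ?_⟩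
    have h₁ : ratCode (t : ℚ) = [t, 0, 1] := by simp [ratCode]
    have h₂ : ratCode (-(t : ℚ)) = [0, t, 1] := by simp [ratCode]
    simp [Program.code, inputProgram, NodeCond.code, h₁, h₂]
  refine Primrec.to_comp (Primrec.of_eq ?_ fun t => (h t).symm)
  exact Primrec.list_append.comp (.const l₁) (Primrec.list_cons.comp .id
    (Primrec.list_append.comp (.const l₂) (Primrec.list_cons.comp .id (.const l₃))))

/-- The domain of a partial recursive function reduces to the satisfiability of graph linear
programs. -/
theorem exists_reduction {f : ℕ →. ℕ} (hf : Partrec f) :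
    ∃ P : ℕ → Program, (Computable fun t => (P t).code) ∧ ∀ t, (P t).Satisfiable ↔ (f t).Dom := by
  obtain ⟨R, ⟨ι, _, leaf, node, entry, hl, hn, he, hR⟩, hRf⟩ := exists_definable_dom hf
  let e := Fintype.equivFin (TreeCoord ι)
  -- The formula depends on `f` alone; the input enters only through the constants of
  -- `inputProgram`.
  obtain ⟨φ, hφ⟩ := LinDef.exists_nodeCond
    ((TreeCoord.linDef_local hl hn he).comap
      (fun k => Sum.inl (e k)) (fun k => Sum.inr (e k)))
  refine ⟨inputProgram (e TreeCoord.input) (e TreeCoord.root) φ,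
    inputProgram_code_computable _ _ φ, fun t => ?_⟩
  rw [inputProgram_satisfiable, ← hRf t, hR]
  simp only [hφ, Sum.elim_inl, Sum.elim_inr]
  constructor
  · rintro ⟨G, h₁, h₂, h₃⟩
    exact exists_entry_der_of_local G h₁ h₂ h₃
  · rintro ⟨w, hw, h⟩
    exact exists_graph_of_entry_der e hw h

end GLP

/-- Graph Linear Programming is undecidable. -/
theorem theorem3 : ¬ GLP.IsDecidable GLP.Program.code GLP.Program.Satisfiable := by
  rintro ⟨g, hg, h⟩
  -- The input is the number of a machine, run on 0, so the domain of this single function is the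
  -- halting problem.
  have hf : Partrec fun n : ℕ => (Denumerable.ofNat Nat.Partrec.Code n).eval 0 :=
    Nat.Partrec.Code.eval_part.comp (Computable.ofNat _) (Computable.const 0)
  obtain ⟨P, hP, hPf⟩ := GLP.exists_reduction hf
  refine ComputablePred.halting_problem 0 (ComputablePred.computable_iff.2
    ⟨fun c => g (P (Encodable.encode c)).code, hg.comp (hP.comp Computable.encode), ?_⟩)
  ext c
  simp [h, hPf]
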